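/- Let $\mathbb K$ be a field of characteristic different from $2$, let $n\ge 0$, and let $q_{ij}\in\mathbb K^*$ ($1\le i,j\le n$) satisfy $q_{ij}q_{ji}=1$ for all $i\ne j$. Let $V$ be a vector space with basis $v_1,\dots,v_n$ and let $$\Lambda=\Lambda_{\mathbf q}(V)=\mathbb K\langle v_1,\dots,v_n\mid v_jv_i=q_{ij}v_iv_j\ (i\ne j),\ v_i^2=0\rangle$$ be the quantum exterior algebra, with enveloping algebra $\Lambda^e=\Lambda\otimes\Lambda^{op}$ (all tensor products are over $\mathbb K$). For $\beta\in\mathbb N^n$ put $|\beta|=\beta_1+\dots+\beta_n$ and let $[j]$ be the $j$-th standard basis vector. Define $f_\beta\in V^{\otimes|\beta|}$ by $f_0=1$, $f_\beta=0$ if some $\beta_j<0$, and $$f_\beta=\sum_{j=1}^n\Big(\prod_{k>j}(-q_{kj})^{\beta_k}\Big)f_{\beta-[j]}\otimes v_j\qquad(\beta\neq0),$$ and put $\epsilon_\beta=1\otimes f_\beta\otimes1\in\Lambda\otimes\Lambda^{\otimes|\beta|}\otimes\Lambda$. For $m\ge0$ let $\mathbf C_m=\sum_{|\beta|=m}\Lambda\epsilon_\beta\Lambda\subseteq\Lambda\otimes\Lambda^{\otimes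 m}\otimes\Lambda$. Then: (a) for every $m$ the sum is direct, $\mathbf C_m=\bigoplus_{|\beta|=m}\Lambda\epsilon_\beta\Lambda$; (b) there are (necessarily unique) $\Lambda^e$-linear maps $d_m:\mathbf C_m\to\mathbf C_{m-1}$ ($m\ge1$) with $$d_m(\epsilon_\beta)=\sum_{j=1}^n(-1)^{\sum_{l<j}\beta_l}\Big(\prod_{l<j}q_{jl}^{\beta_l}\,v_j\epsilon_{\beta-[j]}+(-1)^{\beta_j}\prod_{l>j}q_{lj}^{\beta_l}\,\epsilon_{\beta-[j]}v_j\Big)\qquad(|\beta|=m),$$ where $\epsilon_{\beta-[j]}=0$ if $\beta_j=0$, and a (unique) $\Lambda^e$-linear map $\mu:\mathbf C_0\to\Lambda$ with $\mu(\epsilon_0)=1$ (multiplication); (c) the sequence $$\cdots\xrightarrow{d_3}\mathbf C_2\xrightarrow{d_2}\mathbf C_1\xrightarrow{d_1}\mathbf C_0\xrightarrow{\mu}\Lambda\to0$$ is a graded projective resolution of $\Lambda$ as a $\Lambda^e$-module: it is exact, each $\mathbf C_m$ is a projective $\Lambda^e$-module, and $\Lambda$, $\Lambda^e$ and all $\mathbf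 C_m$ are graded and $d_m$, $\mu$ preserve degrees, both for the $\mathbb N^n$-grading with $\deg v_j=[j]$, $\deg\epsilon_\beta=\beta$ and for the $\mathbb N$-grading with $\deg v_j=1$, $\deg\epsilon_\beta=|\beta|$. -/

import Mathlib

open scoped TensorProduct

noncomputable section

namespace QuantumExterior

/-- The defining relations of the quantum exterior algebra on the generators `v_1, …, v_n`:
`v_j v_i = q_{ij} v_i v_j` for `i ≠ j`, and `v_i ^ 2 = 0`. -/
inductive Rel {K : Type*} [Field K] {n : ℕ} (q : Fin n → Fin n → K) :
    FreeAlgebra K (Fin n) → FreeAlgebra K (Fin n) → Prop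
  | comm (i j : Fin n) (h : i ≠ j) :
      Rel q (FreeAlgebra.ι K j * FreeAlgebra.ι K i)
        (q i j • (FreeAlgebra.ι K i * FreeAlgebra.ι K j))
  | sq (i : Fin n) : Rel q (FreeAlgebra.ι K i * FreeAlgebra.ι K i) 0

/-- The quantum exterior algebra `Λ_q(V)`, where `V` has basis `v_1, …, v_n`. -/
def Lam {K : Type*} [Field K] {n : ℕ} (q : Fin n → Fin n → K) : Type _ := RingQuot (Rel q)

variable {K : Type*} [Field K] {n : ℕ} (q : Fin n → Fin n → K)

instance : Ring (Lam q) := inferInstanceAs (Ring (RingQuot (Rel q)))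

instance : Algebra K (Lam q) := inferInstanceAs (Algebra K (RingQuot (Rel q)))

/-- The quotient map from the free algebra. -/
def quot : FreeAlgebra K (Fin n) →ₐ[K] Lam q := RingQuot.mkAlgHom K (Rel q)

theorem quot_rel {x y : FreeAlgebra K (Fin n)} (h : Rel q x y) : quot q x = quot q y :=
  RingQuot.mkAlgHom_rel K h

/-- The generator `v_i` of `Λ_q(V)`. -/
def v (i : Fin n) : Lam q := quot q (FreeAlgebra.ι K i)

theorem v_comm {i j : Fin n} (h : i ≠ j) : v q j * v q i = q i j • (v q i * v q j) := by
  have := quot_rel q (Rel.comm i j h)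
  rw [map_mul, map_smul, map_mul] at this
  exact this

theorem v_sq (i : Fin n) : v q i * v q i = 0 := by
  have := quot_rel q (Rel.sq i)
  rw [map_mul, map_zero] at this
  exact this

/-- The enveloping algebra `Λ_q(V)^e = Λ_q(V) ⊗ Λ_q(V)^op`. -/
abbrev Env : Type _ := Lam q ⊗[K] (Lam q)ᵐᵒᵖ

/-- `Λ_q(V)` as a `Λ_q(V)^e`-module: `(a ⊗ b) • x = a x b`. -/
instance : Module (Env q) (Lam q) :=
  Module.compHom (Lam q) (AlgHom.mulLeftRight K (Lam q)).toRingHom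

theorem env_smul_lam (a b x : Lam q) :
    ((a ⊗ₜ[K] MulOpposite.op b : Env q) • x : Lam q) = a * x * b :=
  AlgHom.mulLeftRight_apply K (Lam q) a (MulOpposite.op b) x

instance : IsScalarTower K (Env q) (Lam q) where
  smul_assoc c r x := by
    change AlgHom.mulLeftRight K (Lam q) (c • r) x = c • AlgHom.mulLeftRight K (Lam q) r x
    rw [map_smul, LinearMap.smul_apply]

/-- The sum over all `m` of the terms `Λ ⊗ Λ^{⊗ m} ⊗ Λ` of the bar resolution of `Λ = Λ_q(V)`,
that is, `Λ ⊗ T(Λ) ⊗ Λ` with `T(Λ) = ⨁ₘ Λ^{⊗ m}` the tensor algebra over `K` of the vector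
space `Λ`. -/
def Bar : Type _ := Lam q ⊗[K] (TensorAlgebra K (Lam q) ⊗[K] Lam q)

instance : AddCommGroup (Bar q) :=
  inferInstanceAs (AddCommGroup (Lam q ⊗[K] (TensorAlgebra K (Lam q) ⊗[K] Lam q)))

instance : Module K (Bar q) :=
  inferInstanceAs (Module K (Lam q ⊗[K] (TensorAlgebra K (Lam q) ⊗[K] Lam q)))

/-- The element `a ⊗ t ⊗ b`; for `t = a₁ ⊗ ⋯ ⊗ aₘ` it is `a ⊗ a₁ ⊗ ⋯ ⊗ aₘ ⊗ b`. -/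
def barTmul (a : Lam q) (t : TensorAlgebra K (Lam q)) (b : Lam q) : Bar q :=
  a ⊗ₜ[K] (t ⊗ₜ[K] b)

/-- Left multiplication on the first factor of `Λ ⊗ T(Λ) ⊗ Λ`. -/
def barLeft : Lam q →ₐ[K] Module.End K (Lam q ⊗[K] (TensorAlgebra K (Lam q) ⊗[K] Lam q)) :=
  (Module.End.rTensorAlgHom K (Lam q) (TensorAlgebra K (Lam q) ⊗[K] Lam q)).comp
    (Algebra.lmul K (Lam q))

/-- Right multiplication on the last factor of `Λ ⊗ T(Λ) ⊗ Λ`. -/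
def barRight :
    (Lam q)ᵐᵒᵖ →ₐ[K] Module.End K (Lam q ⊗[K] (TensorAlgebra K (Lam q) ⊗[K] Lam q)) :=
  (Module.End.lTensorAlgHom K (TensorAlgebra K (Lam q) ⊗[K] Lam q) (Lam q)).comp
    ((Module.End.lTensorAlgHom K (Lam q) (TensorAlgebra K (Lam q))).comp
      (Algebra.lsmul K K (Lam q)))

theorem barLeft_barRight (a : Lam q) (b : (Lam q)ᵐᵒᵖ) :
    Commute (barLeft q a) (barRight q b) := by
  refine TensorProduct.ext' fun x y => ?_
  rfl

/-- The outer action of `Λ^e` on `Λ ⊗ T(Λ) ⊗ Λ`, see `env_smul_barTmul`. -/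
def barAction : Env q →ₐ[K] Module.End K (Lam q ⊗[K] (TensorAlgebra K (Lam q) ⊗[K] Lam q)) :=
  Algebra.TensorProduct.lift (barLeft q) (barRight q) (barLeft_barRight q)

instance : Module (Env q) (Bar q) :=
  Module.compHom (Lam q ⊗[K] (TensorAlgebra K (Lam q) ⊗[K] Lam q)) (barAction q).toRingHom

instance : IsScalarTower K (Env q) (Bar q) where
  smul_assoc c r x := by
    exact LinearMap.congr_fun (map_smul (barAction q) c r) x

theorem env_smul_barTmul (a b x y : Lam q) (t : TensorAlgebra K (Lam q)) :
    (a ⊗ₜ[K] MulOpposite.op b : Env q) • barTmul q x t y = barTmul q (a * x) t (y * b) := by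
  change barAction q (a ⊗ₜ[K] MulOpposite.op b) (x ⊗ₜ[K] (t ⊗ₜ[K] y)) = _
  rw [barAction, Algebra.TensorProduct.lift_tmul]
  rfl

/-- The length `|β| = β_1 + ⋯ + β_n`. -/
def len (β : Fin n → ℕ) : ℕ := ∑ i, β i

/-- The multi-indices `β ∈ ℕ^n` with `|β| = m`. -/
abbrev MultiIndex (n m : ℕ) : Type := {β : Fin n → ℕ // len β = m}

/-- Auxiliary recursion for `f`; the first argument is the length of the multi-index. -/
def fAux : ℕ → (Fin n → ℕ) → TensorAlgebra K (Lam q)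
  | 0, _ => 1
  | m + 1, β => ∑ j, if β j = 0 then 0 else
      (∏ k ∈ Finset.Ioi j, (-q k j) ^ β k) •
        (fAux m (β - Pi.single j 1) * TensorAlgebra.ι K (v q j))

/-- The element `f_β` of `V^{⊗ |β|} ⊆ Λ^{⊗ |β|} ⊆ T(Λ)`: `f_0 = 1` and
`f_β = ∑_j (∏_{k > j} (-q_{kj})^{β_k}) f_{β - [j]} ⊗ v_j`, where the terms with `β_j = 0` vanish
(see `f_zero` and `f_rec`). -/
def f (β : Fin n → ℕ) : TensorAlgebra K (Lam q) := fAux q (len β) β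

theorem len_sub_single {β : Fin n → ℕ} {j : Fin n} (h : β j ≠ 0) :
    len (β - Pi.single j 1) + 1 = len β := by
  have h1 : len (β - Pi.single j 1) + len (Pi.single j 1 : Fin n → ℕ) = len β := by
    unfold len
    rw [← Finset.sum_add_distrib]
    refine Finset.sum_congr rfl fun i _ => ?_
    by_cases hi : i = j
    · subst hi
      simp only [Pi.sub_apply, Pi.single_eq_same]
      omega
    · simp [hi]
  rwa [show len (Pi.single j 1 : Fin n → ℕ) = 1 by simp [len]] at h1

theorem f_zero : f q 0 = 1 := by
  have : len (0 : Fin n → ℕ) = 0 := by simp [len]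
  rw [f, this, fAux]

theorem f_rec {β : Fin n → ℕ} (h : β ≠ 0) :
    f q β = ∑ j, if β j = 0 then 0 else
      (∏ k ∈ Finset.Ioi j, (-q k j) ^ β k) •
        (f q (β - Pi.single j 1) * TensorAlgebra.ι K (v q j)) := by
  obtain ⟨i, hi⟩ := Function.ne_iff.mp h
  have hi' : β i ≠ 0 := hi
  conv_lhs => rw [f, ← len_sub_single hi', fAux]
  refine Finset.sum_congr rfl fun j _ => ?_
  split_ifs with hj
  · rfl
  · rw [f]
    have h1 := len_sub_single hi'
    have h2 := len_sub_single hj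
    rw [show len (β - Pi.single i 1) = len (β - Pi.single j 1) by omega]

/-- The element `ε_β = 1 ⊗ f_β ⊗ 1` of the bar resolution. -/
def eps (β : Fin n → ℕ) : Bar q := barTmul q 1 (f q β) 1

/-- The module `Λ ε_β Λ`, the sub-bimodule of the bar resolution generated by `ε_β`. -/
def epsSpan (β : Fin n → ℕ) : Submodule (Env q) (Bar q) := Submodule.span (Env q) {eps q β}

/-- The term `C_m`, the sum of the `Λ ε_β Λ` over all `β` with `|β| = m`. -/
def C (m : ℕ) : Submodule (Env q) (Bar q) := ⨆ β : MultiIndex n m, epsSpan q β.1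

/-- The generator `ε_β` as an element of `C_m`, where `m = |β|`. -/
def gen {m : ℕ} (β : MultiIndex n m) : C q m :=
  ⟨eps q β.1, Submodule.mem_iSup_of_mem (p := fun β : MultiIndex n m => epsSpan q β.1) β
    (Submodule.mem_span_singleton_self _)⟩

/-- The element `ε_{β - [j]}` of `C_m`, where `|β| = m + 1`; it is `0` if `β_j = 0`. -/
def genSub {m : ℕ} (β : MultiIndex n (m + 1)) (j : Fin n) : C q m :=
  if h : β.1 j = 0 then 0 else
    gen q ⟨β.1 - Pi.single j 1, by have := len_sub_single h; have := β.2; omega⟩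

/-- `d` is the differential of the complex `C`, that is, the family of `Λ^e`-linear maps
`C_{m+1} → C_m` with
`d(ε_β) = ∑_j (-1)^{∑_{l<j} β_l} (∏_{l<j} q_{jl}^{β_l} v_j ε_{β-[j]}
  + (-1)^{β_j} ∏_{l>j} q_{lj}^{β_l} ε_{β-[j]} v_j)`.
Since the `ε_β` with `|β| = m + 1` generate `C_{m+1}`, there is at most one such family. -/
def IsDifferential (d : ∀ m, C q (m + 1) →ₗ[Env q] C q m) : Prop :=
  ∀ (m : ℕ) (β : MultiIndex n (m + 1)),
    d m (gen q β) = ∑ j, (-1 : K) ^ (∑ l ∈ Finset.Iio j, β.1 l) •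
      ((∏ l ∈ Finset.Iio j, q j l ^ β.1 l) •
          ((v q j ⊗ₜ[K] 1 : Env q) • genSub q β j) +
        ((-1 : K) ^ β.1 j * ∏ l ∈ Finset.Ioi j, q l j ^ β.1 l) •
          ((1 ⊗ₜ[K] MulOpposite.op (v q j) : Env q) • genSub q β j))

/-- `μ` is the augmentation `C_0 = Λ ε_0 Λ → Λ` given by multiplication, that is, the
`Λ^e`-linear map with `ε_0 ↦ 1`, so that `a ε_0 b ↦ a b`. -/
def IsAugmentation (μ : C q 0 →ₗ[Env q] Lam q) : Prop :=
  μ (gen q ⟨0, by simp [len]⟩) = 1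

section Grading

variable {ι : Type*} [AddCommMonoid ι] (w : Fin n → ι)

/-- The grading of `Λ_q(V)` in which `v_i` has degree `w i`: the part of degree `g` is spanned by
the products `v_{i_1} ⋯ v_{i_k}` with `w i_1 + ⋯ + w i_k = g`. -/
def lamDeg (g : ι) : Submodule K (Lam q) :=
  Submodule.span K {x | ∃ s : List (Fin n), (s.map w).sum = g ∧ x = (s.map (v q)).prod}

/-- The induced grading of `Λ^e = Λ ⊗ Λ^op`: `deg (a ⊗ b) = deg a + deg b`. -/
def envDeg (g : ι) : Submodule K (Env q) :=
  Submodule.span K {r | ∃ h k : ι, h + k = g ∧ ∃ a ∈ lamDeg q w h, ∃ b ∈ lamDeg q w k,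
    r = a ⊗ₜ[K] MulOpposite.op b}

/-- The grading of `C_m` in which `ε_β` has degree `∑_i β_i w_i`. -/
def CDeg (m : ℕ) (g : ι) : Submodule K (C q m) :=
  Submodule.span K {x | ∃ β : MultiIndex n m, ∃ h : ι, h + ∑ i, β.1 i • w i = g ∧
    ∃ r ∈ envDeg q w h, x = r • gen q β}

end Grading

/-- The subspaces `𝓡 g` make the `K`-algebra `R` into a graded algebra. -/
structure IsGradedAlgebra {ι K R : Type*} [AddCommMonoid ι] [DecidableEq ι] [Field K] [Ring R]
    [Algebra K R] (𝓡 : ι → Submodule K R) : Prop where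
  gradedMonoid : SetLike.GradedMonoid 𝓡
  isInternal : DirectSum.IsInternal 𝓡

/-- The subspaces `𝓜 g` make the `R`-module `M` into a graded module over the graded algebra
`R`. -/
structure IsGradedModule {ι K R M : Type*} [AddCommMonoid ι] [DecidableEq ι] [Field K] [Ring R]
    [Algebra K R] [AddCommGroup M] [Module K M] [Module R M]
    (𝓡 : ι → Submodule K R) (𝓜 : ι → Submodule K M) : Prop where
  gradedSMul : SetLike.GradedSMul 𝓡 𝓜
  isInternal : DirectSum.IsInternal 𝓜

/-- `⋯ → P_2 → P_1 → P_0 → M → 0` is a graded projective resolution of the graded `R`-module `M`: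
an exact sequence of graded `R`-modules and `R`-linear maps that preserve degrees, in which each
`P_m` is projective. -/
structure IsGradedProjectiveResolution {ι K R M : Type*} [AddCommMonoid ι] [DecidableEq ι]
    [Field K] [Ring R] [Algebra K R] [AddCommGroup M] [Module K M] [Module R M]
    (𝓡 : ι → Submodule K R) (𝓜 : ι → Submodule K M)
    {P : ℕ → Type*} [∀ m, AddCommGroup (P m)] [∀ m, Module K (P m)] [∀ m, Module R (P m)]
    (𝓟 : ∀ m, ι → Submodule K (P m)) (d : ∀ m, P (m + 1) →ₗ[R] P m) (μ : P 0 →ₗ[R] M) :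
    Prop where
  gradedAlgebra : IsGradedAlgebra 𝓡
  gradedModule : IsGradedModule 𝓡 𝓜
  gradedTerm : ∀ m, IsGradedModule 𝓡 (𝓟 m)
  projective : ∀ m, Module.Projective R (P m)
  d_mem : ∀ m g x, x ∈ 𝓟 (m + 1) g → d m x ∈ 𝓟 m g
  aug_mem : ∀ g x, x ∈ 𝓟 0 g → μ x ∈ 𝓜 g
  exact : ∀ m, Function.Exact (d (m + 1)) (d m)
  exact_zero : Function.Exact (d 0) μ
  surjective : Function.Surjective μ

end QuantumExterior

end

/-! The `ε_β` are linearly independent over `Λ^e`, so each `C_m` is free on those with `|β| = m`;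
this gives the direct sums, projectivity and the existence of `d` and `μ`. Independence
(`linearIndependent_eps`) holds because `f_β` contains the ordered word `v_1^{β_1} ⋯ v_n^{β_n}` with
coefficient `1` and no other ordered word.

Identify the sum of all `C_m` with the free module on `ℕ^n`. There `d² = 0` because the two ways of
removing `[i]` and `[k]` cancel (`diff_diff`). For exactness, each `j` has a skew derivation `∂_j`
of `Λ` with `∂_j(a v_j) = a - ∂_j(a) v_j` and `∂_j(a v_i) = q_{ij} ∂_j(a) v_i` for `i ≠ j`. Extended
to `Λ^e`, it gives the `K`-linear map `h_j : r ε_β ↦ c⁻¹ ∂_j(r) ε_{β+[j]}`, where `c` is the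
coefficient `leftCoeff q β j`. The operator `1 - (d h_j + h_j d)` is diagonal in `β` and vanishes
where `β_j ≠ 0`. Hence a cycle is homologous to one supported on its old support intersected with
`β_j = 0`. Running through all `j` leaves at most the index `0`, which does not occur in positive
degree (`exists_diff_eq`).

In degree `0`, the kernel of multiplication is the left ideal generated by the `v_j ⊗ 1 - 1 ⊗ v_j =
d(ε_{[j]}) / ε_0` (`smul_one_eq_zero_iff`). The gradings come from the coaction `v_i ↦ v_i ⊗ w_i` of
the monoid algebra, which separates the homogeneous components. -/

noncomputable section

namespace QuantumExterior

variable {K : Type*} [Field K] {n : ℕ} (q : Fin n → Fin n → K)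

/-! ### Universal property of `Λ` and its spanning words. -/

section Algebra

variable {A : Type*} [Ring A] [Algebra K A]

/-- The universal property of the quantum exterior algebra. -/
def lamLift (x : Fin n → A) (hc : ∀ i j, i ≠ j → x j * x i = q i j • (x i * x j))
    (hs : ∀ i, x i * x i = 0) : Lam q →ₐ[K] A :=
  RingQuot.liftAlgHom K ⟨FreeAlgebra.lift K x, by
    rintro _ _ (⟨i, j, h⟩ | ⟨i⟩)
    · simpa using hc i j h
    · simpa using hs i⟩

theorem lamLift_v (x : Fin n → A) (hc : ∀ i j, i ≠ j → x j * x i = q i j • (x i * x j))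
    (hs : ∀ i, x i * x i = 0) (i : Fin n) : lamLift q x hc hs (v q i) = x i := by
  have := RingQuot.liftAlgHom_mkAlgHom_apply K (s := Rel q) (FreeAlgebra.lift K x) (by
    rintro _ _ (⟨i, j, h⟩ | ⟨i⟩)
    · simpa using hc i j h
    · simpa using hs i) (FreeAlgebra.ι K i)
  rw [FreeAlgebra.lift_ι_apply] at this
  exact this

end Algebra

/-- The products of generators span `Λ`. -/
theorem span_words :
    Submodule.span K (Set.range fun s : List (Fin n) => (s.map (v q)).prod) = ⊤ := by
  rw [eq_top_iff]
  rintro x -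
  obtain ⟨y, rfl⟩ := RingQuot.mkAlgHom_surjective K (Rel q) x
  change quot q y ∈ _
  induction y using FreeAlgebra.induction with
  | grade0 r =>
    rw [AlgHom.commutes, Algebra.algebraMap_eq_smul_one]
    exact Submodule.smul_mem _ _ (Submodule.subset_span ⟨[], by simp⟩)
  | grade1 i => exact Submodule.subset_span ⟨[i], by simp [v]⟩
  | mul a b ha hb =>
    rw [map_mul]
    refine (Submodule.span_mul_span K _ _).le.trans (Submodule.span_mono ?_)
      (Submodule.mul_mem_mul ha hb)
    rintro _ ⟨_, ⟨s, rfl⟩, _, ⟨t, rfl⟩, rfl⟩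
    exact ⟨s ++ t, by simp⟩
  | add a b ha hb =>
    rw [map_add]
    exact Submodule.add_mem _ ha hb

/-- Induction on the elements of `Λ` by right multiplication with generators. -/
theorem lam_induction {P : Lam q → Prop} (one : P 1) (mul_v : ∀ a i, P a → P (a * v q i))
    (add : ∀ a b, P a → P b → P (a + b)) (smul : ∀ (c : K) a, P a → P (c • a)) (x : Lam q) :
    P x := by
  have hx : x ∈ Submodule.span K (Set.range fun s : List (Fin n) => (s.map (v q)).prod) := by
    rw [span_words]
    trivial
  induction hx using Submodule.span_induction with
  | mem x h =>
    obtain ⟨s, rfl⟩ := h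
    induction s using List.reverseRecOn with
    | nil => simpa using one
    | append_singleton s i ih =>
      simpa using mul_v _ i ih
  | zero => simpa using smul 0 1 one
  | add a b _ _ ha hb => exact add a b ha hb
  | smul c a _ ha => exact smul c a ha

/-! ### Skew derivations of `Λ`. -/

section Skew

variable (hq : ∀ i j, i ≠ j → q i j * q j i = 1) (j : Fin n)

/-- The scalar by which the automorphism of `Λ` belonging to the `j`-th skew derivation multiplies
`v_i`. -/
def twist (i : Fin n) : K := if i = j then -1 else q i j

/-- The homomorphism of `Λ` to the upper triangular matrices that defines the `j`-th skew
derivation: `v_i` goes to the matrix with diagonal entries `v_i`, `twist q j i • v_i` and with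
`δ_{ij}` above the diagonal. -/
def skewHom : Lam q →ₐ[K] Matrix (Fin 2) (Fin 2) (Lam q) :=
  lamLift q (fun i => !![v q i, if i = j then 1 else 0; 0, twist q j i • v q i])
    (by
      intro i k h
      have hc := v_comm q h
      ext a b
      fin_cases a <;> fin_cases b
      · by_cases hi : i = j
        · subst hi
          simp [Matrix.mul_apply, Fin.sum_univ_two, hc]
        · simp [Matrix.mul_apply, Fin.sum_univ_two, hc, hi]
      -- The corner entry carries the skew Leibniz rule; for `i = j` it reads `v_k = q_{jk} q_{kj}
      -- v_k`, which is where the inverse relation enters.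
      · by_cases hi : i = j
        · subst hi
          simp [Matrix.mul_apply, Fin.sum_univ_two, twist, h.symm, smul_smul, hq _ _ h]
        · by_cases hk : k = j
          · subst hk
            simp [Matrix.mul_apply, Fin.sum_univ_two, twist, h]
          · simp [Matrix.mul_apply, Fin.sum_univ_two, hi, hk]
      · simp [Matrix.mul_apply, Fin.sum_univ_two]
      · simp [Matrix.mul_apply, Fin.sum_univ_two, hc, smul_smul]
        ring_nf)
    (by
      intro i
      have hs := v_sq q i
      ext a b
      fin_cases a <;> fin_cases b
      · simp [Matrix.mul_apply, Fin.sum_univ_two, hs]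
      -- The sign `-1` in `twist` makes the corner `v_j - v_j` vanish.
      · by_cases hi : i = j
        · subst hi
          simp [Matrix.mul_apply, Fin.sum_univ_two, twist]
        · simp [Matrix.mul_apply, Fin.sum_univ_two, hi]
      · simp [Matrix.mul_apply, Fin.sum_univ_two]
      · simp [Matrix.mul_apply, Fin.sum_univ_two, hs])

theorem skewHom_v (i : Fin n) : skewHom q hq j (v q i) =
    !![v q i, if i = j then 1 else 0; 0, twist q j i • v q i] :=
  lamLift_v q _ _ _ i

theorem skewHom_zero_zero (x : Lam q) : skewHom q hq j x 0 0 = x := by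
  induction x using lam_induction with
  | one => simp
  | mul_v a i ha => simp [Matrix.mul_apply, Fin.sum_univ_two, skewHom_v, ha]
  | add a b ha hb => simp [ha, hb]
  | smul c a ha => simp [ha]

/-- The skew derivation `∂_j` of `Λ` with `∂_j v_i = δ_{ij}`. -/
def skew : Lam q →ₗ[K] Lam q where
  toFun x := skewHom q hq j x 0 1
  map_add' x y := by simp
  map_smul' c x := by simp

theorem skew_mul_v_self (a : Lam q) :
    skew q hq j (a * v q j) = a - skew q hq j a * v q j := by
  simp [skew, Matrix.mul_apply, Fin.sum_univ_two, skewHom_v, twist, skewHom_zero_zero,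
    sub_eq_add_neg]

theorem skew_mul_v_ne {i : Fin n} (h : i ≠ j) (a : Lam q) :
    skew q hq j (a * v q i) = q i j • (skew q hq j a * v q i) := by
  simp [skew, Matrix.mul_apply, Fin.sum_univ_two, skewHom_v, twist, h]

end Skew

/-! ### Ordered words and the freeness of `C_m`. -/

/-- The linear functional on `Λ` that gives the coefficient of `v_j`. -/
def coord (j : Fin n) : Lam q →ₗ[K] K :=
  TrivSqZeroExt.sndHom K K ∘ₗ
    (lamLift q (A := DualNumber K) (fun i => if i = j then DualNumber.eps else 0)
      (fun i k _ => by split_ifs <;> simp) (fun i => by split_ifs <;> simp)).toLinearMap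

theorem coord_v (i j : Fin n) : coord q j (v q i) = if i = j then 1 else 0 := by
  simp only [coord, LinearMap.comp_apply, AlgHom.toLinearMap_apply, lamLift_v]
  split_ifs <;> simp

/-- The operator that appends the letter `j` to the ordered word with content `γ` if the result
is again ordered, and gives `0` otherwise. -/
def append (j : Fin n) : Module.End K ((Fin n → ℕ) →₀ K) :=
  Finsupp.lsum K fun γ => if ∀ k, j < k → γ k = 0 then
    Finsupp.lsingle (γ + Pi.single j 1) else 0

theorem append_single (j : Fin n) (γ : Fin n → ℕ) (c : K) :
    append j (Finsupp.single γ c) = if ∀ k, j < k → γ k = 0 then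
      Finsupp.single (γ + Pi.single j 1) c else 0 := by
  rw [append, Finsupp.lsum_single]
  split_ifs <;> simp

/-- The right action of the tensor algebra in which `Λ` acts through the operators `append j`. -/
def appendHom : TensorAlgebra K (Lam q) →ₐ[K] (Module.End K ((Fin n → ℕ) →₀ K))ᵐᵒᵖ :=
  TensorAlgebra.lift K ((MulOpposite.opLinearEquiv K).toLinearMap ∘ₗ
    ∑ j, (coord q j).smulRight (append j))

theorem appendHom_ι_v (j : Fin n) :
    appendHom q (TensorAlgebra.ι K (v q j)) = MulOpposite.op (append j) := by
  simp [appendHom, coord_v]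

/-- The linear map on the tensor algebra that gives the coefficients of the ordered words in the
`v_j`, indexed by their content. -/
def wordCoeff : TensorAlgebra K (Lam q) →ₗ[K] (Fin n → ℕ) →₀ K :=
  LinearMap.applyₗ (Finsupp.single 0 1) ∘ₗ
    (MulOpposite.opLinearEquiv K).symm.toLinearMap ∘ₗ (appendHom q).toLinearMap

theorem wordCoeff_one : wordCoeff q 1 = Finsupp.single 0 1 := by
  simp [wordCoeff]

theorem wordCoeff_mul_v (t : TensorAlgebra K (Lam q)) (j : Fin n) :
    wordCoeff q (t * TensorAlgebra.ι K (v q j)) = append j (wordCoeff q t) := by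
  simp [wordCoeff, appendHom_ι_v]

theorem sub_single_add {β : Fin n → ℕ} {j : Fin n} (h : β j ≠ 0) :
    β - Pi.single j 1 + Pi.single j 1 = β := by
  refine tsub_add_cancel_of_le fun i => ?_
  by_cases hi : i = j
  · subst hi
    simp only [Pi.single_eq_same]
    omega
  · simp [hi]

/-- An ordered word with content `β` must end in the largest letter `i` that occurs in `β`. So only
the summand `j = i` of the recursion contributes, and its scalar is an empty product since `β`
vanishes beyond `i`. -/
theorem wordCoeff_f (β : Fin n → ℕ) : wordCoeff q (f q β) = Finsupp.single β 1 := by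
  induction hm : len β generalizing β with
  | zero =>
    have : β = 0 := by
      ext i
      simpa using (Finset.sum_eq_zero_iff.mp hm) i (Finset.mem_univ i)
    rw [this, f_zero, wordCoeff_one]
  | succ m ih =>
    have hβ : β ≠ 0 := by
      rintro rfl
      simp [len] at hm
    obtain ⟨i, hi, hmax⟩ : ∃ i, β i ≠ 0 ∧ ∀ k, i < k → β k = 0 := by
      obtain ⟨i₀, hi₀⟩ := Function.ne_iff.mp hβ
      have hne : (Finset.univ.filter fun i => β i ≠ 0).Nonempty := ⟨i₀, by simpa using hi₀⟩
      refine ⟨_, (Finset.mem_filter.mp (Finset.max'_mem _ hne)).2, fun k hk => ?_⟩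
      by_contra h
      exact absurd (Finset.le_max' _ k (by simpa using h)) (not_le.mpr hk)
    rw [f_rec q hβ, map_sum, Finset.sum_eq_single i]
    · rw [if_neg hi, map_smul, wordCoeff_mul_v, ih _ (by have := len_sub_single hi; omega),
        append_single, if_pos, sub_single_add hi, Finset.prod_eq_one, one_smul]
      · intro k hk
        rw [hmax k (Finset.mem_Ioi.mp hk), pow_zero]
      · intro k hk
        simp [hmax k hk]
    · intro j _ hj
      split_ifs with h
      · exact map_zero _
      · rw [map_smul, wordCoeff_mul_v, ih _ (by have := len_sub_single h; omega),
          append_single, if_neg, smul_zero]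
        -- For `j ≠ i` with `β_j ≠ 0`, the index satisfies `j < i`; the letter `i` still occurs in
        -- `β - [j]`, so appending `j` breaks the order.
        intro hall
        have hji : j < i := by
          rcases lt_trichotomy j i with h1 | h1 | h1
          · exact h1
          · exact absurd h1 hj
          · exact absurd (hmax j h1) h
        have := hall i hji
        rw [Pi.sub_apply, Pi.single_eq_of_ne hj.symm] at this
        exact hi this
    · simp

theorem bar_induction {P : Bar q → Prop} (tmul : ∀ a t b, P (barTmul q a t b))
    (add : ∀ x y, P x → P y → P (x + y)) (x : Bar q) : P x := by
  refine TensorProduct.induction_on (motive := P) x ?_ (fun a y => ?_) add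
  · have : (0 : Bar q) = barTmul q 0 0 0 := (TensorProduct.zero_tmul _ _).symm
    exact this ▸ tmul 0 0 0
  · refine TensorProduct.induction_on (motive := fun y => P (a ⊗ₜ y)) y ?_ (tmul a) ?_
    · have : barTmul q a 0 0 = a ⊗ₜ[K] (0 : TensorAlgebra K (Lam q) ⊗[K] Lam q) := by
        rw [barTmul, TensorProduct.zero_tmul]
      exact this ▸ tmul a 0 0
    · intro y z hy hz
      rw [TensorProduct.tmul_add]
      exact add _ _ hy hz

/-- The coefficient, in `Λ^e`, of the ordered word in the `v_j` with content `β`. -/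
def barCoeff (β : Fin n → ℕ) : Bar q →ₗ[K] Env q :=
  (TensorProduct.lid K (Env q)).toLinearMap ∘ₗ
    (TensorProduct.leftComm K (Lam q) K (Lam q)ᵐᵒᵖ).toLinearMap ∘ₗ
      TensorProduct.map LinearMap.id
        (TensorProduct.map (Finsupp.lapply β ∘ₗ wordCoeff q)
          (MulOpposite.opLinearEquiv K).toLinearMap)

theorem barCoeff_barTmul (β : Fin n → ℕ) (a b : Lam q) (t : TensorAlgebra K (Lam q)) :
    barCoeff q β (barTmul q a t b) = wordCoeff q t β • (a ⊗ₜ MulOpposite.op b) :=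
  rfl

theorem barCoeff_smul (β : Fin n → ℕ) (r : Env q) (x : Bar q) :
    barCoeff q β (r • x) = r * barCoeff q β x := by
  induction r using TensorProduct.induction_on with
  | zero => exact (congrArg _ (zero_smul (Env q) x)).trans (by rw [map_zero]; exact (zero_mul _).symm)
  | add r s hr hs => rw [add_smul, map_add, hr, hs, add_mul]
  | tmul a b =>
    obtain ⟨b, rfl⟩ := MulOpposite.op_surjective b
    induction x using bar_induction with
    | tmul c t d =>
      rw [env_smul_barTmul, barCoeff_barTmul, barCoeff_barTmul, mul_smul_comm,
        Algebra.TensorProduct.tmul_mul_tmul, MulOpposite.op_mul]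
    | add x y hx hy => rw [smul_add, map_add, hx, hy, map_add, mul_add]

theorem barCoeff_eps (β γ : Fin n → ℕ) : barCoeff q β (eps q γ) = if γ = β then 1 else 0 := by
  rw [eps, barCoeff_barTmul, wordCoeff_f, Finsupp.single_apply]
  split_ifs
  · rw [one_smul]
    rfl
  · rw [zero_smul]

/-- The `Λ^e`-linear functionals `barCoeff q β` are dual to the `ε_β`. -/
theorem linearIndependent_eps : LinearIndependent (Env q) (eps q) := by
  rw [linearIndependent_iff']
  intro s g hg β hβ
  have h := congrArg (barCoeff q β) hg
  rw [map_sum, map_zero, Finset.sum_eq_single_of_mem β hβ, barCoeff_smul, barCoeff_eps,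
    if_pos rfl, mul_one] at h
  · exact h
  · intro γ _ hγ
    rw [barCoeff_smul, barCoeff_eps, if_neg hγ]
    exact mul_zero _

theorem iSupIndep_epsSpan (m : ℕ) : iSupIndep fun β : MultiIndex n m => epsSpan q β.1 :=
  ((linearIndependent_eps q).comp _ Subtype.val_injective).iSupIndep_span_singleton

theorem span_gen (m : ℕ) :
    Submodule.span (Env q) (Set.range fun β : MultiIndex n m => gen q β) = ⊤ := by
  apply Submodule.map_injective_of_injective (C q m).injective_subtype
  rw [Submodule.map_span, Submodule.map_top, Submodule.range_subtype, ← Set.range_comp]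
  exact Submodule.span_range_eq_iSup

theorem linearIndependent_gen (m : ℕ) :
    LinearIndependent (Env q) fun β : MultiIndex n m => gen q β :=
  LinearIndependent.of_comp (C q m).subtype
    ((linearIndependent_eps q).comp _ Subtype.val_injective)

/-- The `Λ^e`-basis of `C_m` that consists of the `ε_β` with `|β| = m`. -/
def basisC (m : ℕ) : Module.Basis (MultiIndex n m) (Env q) (C q m) :=
  Module.Basis.mk (linearIndependent_gen q m) (span_gen q m).ge

theorem basisC_apply {m : ℕ} (β : MultiIndex n m) : basisC q m β = gen q β :=
  Module.Basis.mk_apply _ _ β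

/-! ### Coefficients of the differential and their change under `β ↦ β + [i]`. -/

section Coefficients

/-- The coefficient of `v_j ε_{β - [j]}` in the differential of `ε_β`. -/
def leftCoeff (β : Fin n → ℕ) (j : Fin n) : K :=
  (-1) ^ (∑ l ∈ Finset.Iio j, β l) * ∏ l ∈ Finset.Iio j, q j l ^ β l

/-- The coefficient of `ε_{β - [j]} v_j` in the differential of `ε_β`. -/
def rightCoeff (β : Fin n → ℕ) (j : Fin n) : K :=
  (-1) ^ (∑ l ∈ Finset.Iio j, β l) * ((-1) ^ β j * ∏ l ∈ Finset.Ioi j, q l j ^ β l)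

theorem leftCoeff_zero (j : Fin n) : leftCoeff q 0 j = 1 := by simp [leftCoeff]

theorem rightCoeff_zero (j : Fin n) : rightCoeff q 0 j = 1 := by simp [rightCoeff]

theorem sum_add_single (s : Finset (Fin n)) (β : Fin n → ℕ) (i : Fin n) :
    ∑ l ∈ s, (β + Pi.single i 1 : Fin n → ℕ) l = ∑ l ∈ s, β l + if i ∈ s then 1 else 0 := by
  simp [Finset.sum_add_distrib, Pi.single_apply]

theorem prod_pow_add_single (s : Finset (Fin n)) (β : Fin n → ℕ) (i : Fin n) (c : Fin n → K) :
    ∏ l ∈ s, c l ^ (β + Pi.single i 1 : Fin n → ℕ) l = (∏ l ∈ s, c l ^ β l) * if i ∈ s then c i else 1 := by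
  simp only [Pi.add_apply, pow_add, Finset.prod_mul_distrib, Pi.single_apply, pow_ite, pow_one,
    pow_zero, Finset.prod_ite_eq']

theorem leftCoeff_add_single (β : Fin n → ℕ) (i j : Fin n) :
    leftCoeff q (β + Pi.single i 1) j = leftCoeff q β j * if i < j then -q j i else 1 := by
  rw [leftCoeff, leftCoeff, sum_add_single, prod_pow_add_single]
  simp only [Finset.mem_Iio]
  split_ifs <;> ring

theorem rightCoeff_add_single (β : Fin n → ℕ) (i j : Fin n) :
    rightCoeff q (β + Pi.single i 1) j = rightCoeff q β j * if i ≤ j then -1 else q i j := by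
  rw [rightCoeff, rightCoeff, sum_add_single, prod_pow_add_single]
  simp only [Finset.mem_Iio, Finset.mem_Ioi, Pi.add_apply]
  rcases lt_trichotomy i j with h | h | h
  · simp only [h, h.le, not_lt.mpr h.le, Pi.single_eq_of_ne h.ne', if_true, if_false]
    ring
  · subst h
    simp only [lt_irrefl, le_refl, Pi.single_eq_same, if_true, if_false]
    ring
  · simp only [h, not_le.mpr h, not_lt.mpr h.le, Pi.single_eq_of_ne h.ne, if_true, if_false]
    ring

theorem leftCoeff_ne_zero (hq0 : ∀ i j, q i j ≠ 0) (β : Fin n → ℕ) (j : Fin n) :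
    leftCoeff q β j ≠ 0 :=
  mul_ne_zero (pow_ne_zero _ (by simp)) (Finset.prod_ne_zero_iff.mpr fun l _ =>
    pow_ne_zero _ (hq0 j l))

end Coefficients

/-- The relations in `Λ^e` between the elements `X i = v_i ⊗ 1` and `Y i = 1 ⊗ v_i`. -/
structure EnvRel {R : Type*} [Ring R] [Algebra K R] (X Y : Fin n → R) : Prop where
  X_comm : ∀ i j, i ≠ j → X j * X i = q i j • (X i * X j)
  X_sq : ∀ i, X i * X i = 0
  Y_comm : ∀ i j, i ≠ j → Y i * Y j = q i j • (Y j * Y i)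
  Y_sq : ∀ i, Y i * Y i = 0
  comm : ∀ i j, Y i * X j = X j * Y i

/-- The identities satisfied by the skew derivations of `Λ`, extended to `Λ^e`. -/
structure SkewRel {R : Type*} [Ring R] [Algebra K R] (X Y : Fin n → R)
    (S : Fin n → R →ₗ[K] R) : Prop where
  mul_X_self : ∀ j r, S j (r * X j) = r - S j r * X j
  mul_X_ne : ∀ i j r, i ≠ j → S j (r * X i) = q i j • (S j r * X i)
  mul_Y : ∀ i j r, S j (r * Y i) = S j r * Y i

/-! ### The differential on the free module over `ℕ^n`, for any ring satisfying the relations. -/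

section Complex

variable {R : Type*} [Ring R] [Algebra K R] (X Y : Fin n → R)

/-- The coefficient in `Λ^e` of `ε_{β - [j]}` in the differential of `ε_β`. -/
def diffCoeff (β : Fin n → ℕ) (j : Fin n) : R :=
  leftCoeff q β j • X j + rightCoeff q β j • Y j

/-- The differential on the free module with basis `ℕ^n`. -/
def diff : ((Fin n → ℕ) →₀ R) →ₗ[R] (Fin n → ℕ) →₀ R :=
  Finsupp.linearCombination R fun β => ∑ j, if β j = 0 then 0 else
    Finsupp.single (β - Pi.single j 1) (diffCoeff q X Y β j)

theorem diff_single (β : Fin n → ℕ) (r : R) :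
    diff q X Y (Finsupp.single β r) = ∑ j, if β j = 0 then 0 else
      Finsupp.single (β - Pi.single j 1) (r * diffCoeff q X Y β j) := by
  rw [diff, Finsupp.linearCombination_single, Finset.smul_sum]
  refine Finset.sum_congr rfl fun j _ => ?_
  split_ifs <;> simp

theorem add_single_apply_ne (γ : Fin n → ℕ) {i k : Fin n} (h : k ≠ i) :
    (γ + Pi.single i 1 : Fin n → ℕ) k = γ k := by simp [h]

theorem add_single_sub (γ : Fin n → ℕ) (i : Fin n) :
    γ + Pi.single i 1 - Pi.single i 1 = γ := add_tsub_cancel_right _ _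

variable {X Y} {q}

/-- In the `X X` and `Y Y` terms the scalars gained by shifting `β` cancel the commutation scalar up
to sign, by `q_{ik} q_{ki} = 1`; the mixed terms cancel by sign alone. -/
theorem diffCoeff_mul_add (hq : ∀ i j, i ≠ j → q i j * q j i = 1) (hR : EnvRel q X Y)
    (γ : Fin n → ℕ) {i k : Fin n} (h : i < k) :
    diffCoeff q X Y (γ + Pi.single i 1 + Pi.single k 1) i *
        diffCoeff q X Y (γ + Pi.single k 1) k +
      diffCoeff q X Y (γ + Pi.single i 1 + Pi.single k 1) k *
        diffCoeff q X Y (γ + Pi.single i 1) i = 0 := by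
  have hX := hR.X_comm i k h.ne
  have hY := hR.Y_comm i k h.ne
  have hqq := hq i k h.ne
  simp only [diffCoeff, leftCoeff_add_single, rightCoeff_add_single, h, h.le, h.not_ge, lt_irrefl,
    not_lt.mpr h.le, le_refl, if_true, if_false, mul_add, add_mul, smul_mul_smul_comm, hX, hY,
    hR.comm, smul_smul]
  match_scalars
  · linear_combination (-(leftCoeff q γ i * leftCoeff q γ k)) * hqq
  · ring
  · ring
  · linear_combination (rightCoeff q γ i * rightCoeff q γ k) * hqq

/-- This is `(lX + ρY)(lX - ρY) = 0` for commuting `X`, `Y` of square zero: each further `[i]` flips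
the sign of the right coefficient. -/
theorem diffCoeff_mul_self (hR : EnvRel q X Y) (γ : Fin n → ℕ) (i : Fin n) :
    diffCoeff q X Y (γ + Pi.single i 1 + Pi.single i 1) i *
      diffCoeff q X Y (γ + Pi.single i 1) i = 0 := by
  simp only [diffCoeff, leftCoeff_add_single, rightCoeff_add_single, lt_irrefl,
    le_refl, if_true, if_false, mul_add, add_mul, smul_mul_smul_comm, hR.X_sq, hR.Y_sq,
    hR.comm]
  module

theorem sub_apply_ne (β : Fin n → ℕ) {i k : Fin n} (h : k ≠ i) :
    (β - Pi.single i 1 : Fin n → ℕ) k = β k := by simp [h]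

theorem exists_eq_add_single {β : Fin n → ℕ} {i : Fin n} (h : β i ≠ 0) :
    ∃ γ : Fin n → ℕ, β = γ + Pi.single i 1 :=
  ⟨_, (sub_single_add h).symm⟩

theorem diff_diff (hq : ∀ i j, i ≠ j → q i j * q j i = 1) (hR : EnvRel q X Y)
    (x : (Fin n → ℕ) →₀ R) : diff q X Y (diff q X Y x) = 0 := by
  suffices h : diff q X Y ∘ₗ diff q X Y = 0 from LinearMap.congr_fun h x
  refine Finsupp.lhom_ext' fun β => LinearMap.ext_ring ?_
  -- The contribution to `d²` from removing first `[p.1]`, then `[p.2]`; swapping the pair is the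
  -- cancelling involution, and its fixed points contribute zero.
  let g : Fin n × Fin n → (Fin n → ℕ) →₀ R := fun p => if β p.1 = 0 then 0 else
    if (β - Pi.single p.1 1 : Fin n → ℕ) p.2 = 0 then 0 else
      Finsupp.single (β - Pi.single p.1 1 - Pi.single p.2 1)
        (diffCoeff q X Y β p.1 * diffCoeff q X Y (β - Pi.single p.1 1) p.2)
  have hg : (diff q X Y ∘ₗ diff q X Y) (Finsupp.single β 1) = ∑ p, g p := by
    rw [LinearMap.comp_apply, diff_single, map_sum, Fintype.sum_prod_type]
    refine Finset.sum_congr rfl fun i _ => ?_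
    by_cases hi : β i = 0
    · simp [g, hi]
    · simp only [g, hi, if_false, one_mul, diff_single]
  have hlt : ∀ i k, i < k → g (i, k) + g (k, i) = 0 := by
    intro i k h
    simp only [g, sub_apply_ne β h.ne, sub_apply_ne β h.ne']
    by_cases hi : β i = 0
    · simp [hi]
    by_cases hk : β k = 0
    · simp [hk]
    -- Writing the index as `γ + [k] + [i]` replaces truncated subtraction by addition.
    obtain ⟨γ, rfl⟩ := exists_eq_add_single hi
    rw [add_single_apply_ne γ h.ne'] at hk
    obtain ⟨γ, rfl⟩ := exists_eq_add_single hk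
    simp only [hi, add_single_apply_ne _ h.ne', hk, if_false, add_single_sub]
    rw [add_right_comm, add_single_sub, add_single_sub, ← Finsupp.single_add,
      diffCoeff_mul_add hq hR γ h, Finsupp.single_zero]
  have hself : ∀ i, g (i, i) = 0 := by
    intro i
    simp only [g]
    split_ifs with h1 h2
    · rfl
    · rfl
    · obtain ⟨γ, rfl⟩ := exists_eq_add_single h1
      rw [add_single_sub] at h2 ⊢
      obtain ⟨γ, rfl⟩ := exists_eq_add_single h2
      rw [add_single_sub, diffCoeff_mul_self hR, Finsupp.single_zero]
  refine hg.trans (Finset.sum_involution (fun p _ => p.swap) ?_ ?_ (fun _ _ => Finset.mem_univ _)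
    fun _ _ => Prod.swap_swap _)
  · rintro ⟨i, k⟩ -
    rcases lt_trichotomy i k with h | h | h
    · exact hlt i k h
    · subst h
      simp [hself]
    · exact (add_comm _ _).trans (hlt k i h)
  · rintro ⟨i, k⟩ - hne heq
    obtain rfl : k = i := congrArg Prod.fst heq
    exact hne (hself k)

/-! ### Homotopies from skew derivations, and exactness. -/

variable (q) in
/-- The contracting homotopy in the direction of `v_j`. -/
def homotopy (S : Fin n → R →ₗ[K] R) (j : Fin n) :
    ((Fin n → ℕ) →₀ R) →ₗ[K] (Fin n → ℕ) →₀ R :=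
  Finsupp.lsum K fun β : Fin n → ℕ =>
    Finsupp.lsingle (β + Pi.single j 1) ∘ₗ ((leftCoeff q β j)⁻¹ • S j)

theorem homotopy_single (S : Fin n → R →ₗ[K] R) (j : Fin n) (β : Fin n → ℕ) (r : R) :
    homotopy q S j (Finsupp.single β r) =
      Finsupp.single (β + Pi.single j 1) ((leftCoeff q β j)⁻¹ • S j r) := by
  simp [homotopy]

variable {S : Fin n → R →ₗ[K] R}

/-- Off-diagonal part of `d h_j + h_j d`: the factor `q_{ij}` produced by `∂_j` matches the change
of the coefficients, with opposite sign. -/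
theorem homotopy_coeff_ne (hq0 : ∀ i j, q i j ≠ 0) (hq : ∀ i j, i ≠ j → q i j * q j i = 1)
    (hS : SkewRel q X Y S) (γ : Fin n → ℕ) {i j : Fin n} (h : i ≠ j) (r : R) :
    ((leftCoeff q (γ + Pi.single i 1) j)⁻¹ • S j r) *
        diffCoeff q X Y (γ + Pi.single i 1 + Pi.single j 1) i +
      (leftCoeff q γ j)⁻¹ • S j (r * diffCoeff q X Y (γ + Pi.single i 1) i) = 0 := by
  have hqq := hq i j h
  have h0 := leftCoeff_ne_zero q hq0 γ j
  simp only [diffCoeff, mul_add, mul_smul_comm, smul_mul_assoc, map_add, map_smul,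
    hS.mul_X_ne _ _ _ h, hS.mul_Y, leftCoeff_add_single, rightCoeff_add_single]
  rcases lt_or_gt_of_ne h with h1 | h1
  · have hji : q j i ≠ 0 := hq0 j i
    have hij : q i j = (q j i)⁻¹ := eq_inv_of_mul_eq_one_left hqq
    simp only [h1, h1.not_ge, not_lt.mpr h1.le, lt_irrefl, le_refl, if_true, if_false, hij]
    match_scalars <;> field_simp <;> ring
  · simp only [h1, h1.le, not_lt.mpr h1.le, lt_irrefl, le_refl, if_true, if_false]
    match_scalars <;> field_simp <;> ring

/-- With `l`, `ρ` the coefficients at `γ`, the sum is `l⁻¹ S(r)(lX + ρY) + l⁻¹ S(r(lX - ρY))`; the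
rule `S(rX) = r - S(r)X` leaves exactly `r`. -/
theorem homotopy_coeff_self (hq0 : ∀ i j, q i j ≠ 0)
    (hS : SkewRel q X Y S) (γ : Fin n → ℕ) (j : Fin n) (r : R) :
    ((leftCoeff q (γ + Pi.single j 1) j)⁻¹ • S j r) *
        diffCoeff q X Y (γ + Pi.single j 1 + Pi.single j 1) j +
      (leftCoeff q γ j)⁻¹ • S j (r * diffCoeff q X Y (γ + Pi.single j 1) j) = r := by
  have h0 := leftCoeff_ne_zero q hq0 γ j
  simp only [diffCoeff, mul_add, mul_smul_comm, smul_mul_assoc, map_add, map_smul,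
    hS.mul_X_self, hS.mul_Y, leftCoeff_add_single, rightCoeff_add_single, lt_irrefl, le_refl,
    if_true, if_false]
  match_scalars <;> field_simp <;> ring

theorem exists_sub_homotopy_single (hq0 : ∀ i j, q i j ≠ 0)
    (hq : ∀ i j, i ≠ j → q i j * q j i = 1) (hS : SkewRel q X Y S) (j : Fin n)
    (β : Fin n → ℕ) (r : R) : ∃ r', (β j ≠ 0 → r' = 0) ∧
      Finsupp.single β r - (diff q X Y (homotopy q S j (Finsupp.single β r)) +
        homotopy q S j (diff q X Y (Finsupp.single β r))) = Finsupp.single β r' := by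
  have key : diff q X Y (homotopy q S j (Finsupp.single β r)) +
      homotopy q S j (diff q X Y (Finsupp.single β r)) =
      Finsupp.single β (((leftCoeff q β j)⁻¹ • S j r) *
        diffCoeff q X Y (β + Pi.single j 1) j + if β j = 0 then 0 else
          (leftCoeff q (β - Pi.single j 1) j)⁻¹ • S j (r * diffCoeff q X Y β j)) := by
    rw [homotopy_single, diff_single, diff_single, map_sum, ← Finset.sum_add_distrib,
      Finset.sum_eq_single j]
    · rw [add_single_sub, if_neg (by simp), Finsupp.single_add]
      congr 1
      split_ifs with h
      · simp
      · rw [homotopy_single, sub_single_add h]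
    · intro i _ h
      rw [add_single_apply_ne β h]
      by_cases hi : β i = 0
      · simp [hi]
      · obtain ⟨γ, rfl⟩ := exists_eq_add_single hi
        rw [if_neg hi, if_neg hi, homotopy_single, add_single_sub, add_right_comm γ,
          add_single_sub, add_right_comm γ, ← Finsupp.single_add, homotopy_coeff_ne hq0 hq hS γ h,
          Finsupp.single_zero]
    · simp
  rw [key, ← Finsupp.single_sub]
  refine ⟨_, fun h => ?_, rfl⟩
  obtain ⟨γ, rfl⟩ := exists_eq_add_single h
  rw [if_neg h, add_single_sub, homotopy_coeff_self hq0 hS, sub_self]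

/-- On a cycle, `1 - (d h_j + h_j d)` is subtraction of a boundary; being diagonal, it creates no
new support. -/
theorem sub_homotopy_apply (hq0 : ∀ i j, q i j ≠ 0)
    (hq : ∀ i j, i ≠ j → q i j * q j i = 1) (hS : SkewRel q X Y S) (j : Fin n)
    (x : (Fin n → ℕ) →₀ R) (hx : diff q X Y x = 0) (γ : Fin n → ℕ)
    (h : (x - diff q X Y (homotopy q S j x)) γ ≠ 0) : x γ ≠ 0 ∧ γ j = 0 := by
  let P : ((Fin n → ℕ) →₀ R) →ₗ[K] (Fin n → ℕ) →₀ R := LinearMap.id -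
    ((diff q X Y).restrictScalars K ∘ₗ homotopy q S j +
      homotopy q S j ∘ₗ (diff q X Y).restrictScalars K)
  have hP : ∀ β r, ∃ r', (β j ≠ 0 → r' = 0) ∧ P (Finsupp.single β r) = Finsupp.single β r' :=
    exists_sub_homotopy_single hq0 hq hS j
  have key : ∀ x, P x γ = P (Finsupp.single γ (x γ)) γ := by
    intro x
    induction x using Finsupp.induction_linear with
    | zero => simp
    | add x y hx hy => simp [hx, hy]
    | single β r =>
      by_cases hβ : β = γ
      · simp [hβ]
      · obtain ⟨r', -, hr'⟩ := hP β r
        simp [hr', hβ]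
  have hPx : P x = x - diff q X Y (homotopy q S j x) := by
    simp [P, hx]
  rw [← hPx, key] at h
  refine ⟨fun h0 => h (by simp [h0]), by_contra fun h0 => h ?_⟩
  obtain ⟨r', hr, hr'⟩ := hP γ (x γ)
  rw [hr', hr h0, Finsupp.single_zero, Finsupp.zero_apply]

/-- Apply the homotopies one direction at a time. Supports never grow, so conditions `γ_j = 0`
already achieved persist, and so does the vanishing at `0`. -/
theorem exists_diff_eq (hq0 : ∀ i j, q i j ≠ 0)
    (hq : ∀ i j, i ≠ j → q i j * q j i = 1) (hR : EnvRel q X Y) (hS : SkewRel q X Y S)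
    {x : (Fin n → ℕ) →₀ R} (hx : diff q X Y x = 0) (h0 : x 0 = 0) : ∃ y, diff q X Y y = x := by
  have key : ∀ t : Finset (Fin n), ∃ y, ∀ γ, (x - diff q X Y y) γ ≠ 0 →
      x γ ≠ 0 ∧ ∀ j ∈ t, γ j = 0 := by
    intro t
    induction t using Finset.induction_on with
    | empty => exact ⟨0, fun γ h => by simpa using h⟩
    | insert j t _ ih =>
      obtain ⟨y, hy⟩ := ih
      refine ⟨y + homotopy q S j (x - diff q X Y y), fun γ h => ?_⟩
      rw [map_add, ← sub_sub] at h
      obtain ⟨h1, h2⟩ := sub_homotopy_apply hq0 hq hS j _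
        (by rw [map_sub, hx, diff_diff hq hR, sub_zero]) γ h
      refine ⟨(hy γ h1).1, fun k hk => ?_⟩
      rcases Finset.mem_insert.mp hk with rfl | hk
      · exact h2
      · exact (hy γ h1).2 k hk
  obtain ⟨y, hy⟩ := key Finset.univ
  refine ⟨y, (sub_eq_zero.mp (Finsupp.ext fun γ => ?_)).symm⟩
  by_contra h
  obtain ⟨h1, h2⟩ := hy γ h
  obtain rfl : γ = 0 := funext fun j => h2 j (Finset.mem_univ j)
  exact h1 h0

theorem exists_diff_eq_single_zero (r : R)
    (hr : r ∈ Submodule.span R (Set.range fun j => X j - Y j)) :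
    ∃ y, diff q X Y y = Finsupp.single 0 r := by
  change Finsupp.lsingle (R := R) (0 : Fin n → ℕ) r ∈ LinearMap.range (diff q X Y)
  refine (Submodule.span_le (p := (LinearMap.range (diff q X Y)).comap
    (Finsupp.lsingle (0 : Fin n → ℕ)))).mpr ?_ hr
  rintro _ ⟨j, rfl⟩
  refine ⟨Finsupp.single (Pi.single j 1) 1, ?_⟩
  rw [diff_single, Finset.sum_eq_single j]
  · have hl := leftCoeff_add_single q 0 j j
    have hr := rightCoeff_add_single q 0 j j
    rw [zero_add] at hl hr
    simp [diffCoeff, hl, hr, leftCoeff_zero, rightCoeff_zero, sub_eq_add_neg]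
  · intro i _ h
    simp [h]
  · simp

end Complex

/-! ### Gradings of free modules. -/

theorem isInternal_of_decomposition {ι M : Type*} [DecidableEq ι] [AddCommGroup M]
    [Module K M] {𝓜 : ι → Submodule K M} (D : M →ₗ[K] ι →₀ M)
    (hD : ∀ g, ∀ x ∈ 𝓜 g, D x = Finsupp.single g x) (htop : ⨆ g, 𝓜 g = ⊤) :
    DirectSum.IsInternal 𝓜 := by
  refine DirectSum.isInternal_submodule_of_iSupIndep_of_iSup_eq_top ?_ htop
  rw [iSupIndep_def]
  intro g
  rw [Submodule.disjoint_def]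
  intro x hx hx'
  have h : ∀ y ∈ ⨆ (k) (_ : k ≠ g), 𝓜 k, D y g = 0 := by
    intro y hy
    suffices hle : ⨆ (k) (_ : k ≠ g), 𝓜 k ≤ LinearMap.ker (Finsupp.lapply g ∘ₗ D) from hle hy
    refine iSup₂_le fun k hk y hy => ?_
    simp [hD k y hy, hk]
  simpa [hD g x hx] using h x hx'

section Free

variable {R : Type*} [Ring R] [Algebra K R] {ι : Type*} [AddCommMonoid ι]
  {M κ : Type*} [AddCommGroup M] [Module K M] [Module R M]

/-- The grading of a free module with a basis of elements of prescribed degrees. -/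
def freeDeg (𝓡 : ι → Submodule K R) (b : κ → M) (deg : κ → ι) (g : ι) : Submodule K M :=
  Submodule.span K {x | ∃ β, ∃ h : ι, h + deg β = g ∧ ∃ r ∈ 𝓡 h, x = r • b β}

theorem smul_mem_freeDeg {𝓡 : ι → Submodule K R} {b : κ → M} {deg : κ → ι} {h : ι} {r : R}
    (hr : r ∈ 𝓡 h) (β : κ) : r • b β ∈ freeDeg 𝓡 b deg (h + deg β) :=
  Submodule.subset_span ⟨β, h, rfl, r, hr, rfl⟩

theorem isGradedModule_freeDeg [DecidableEq ι] [IsScalarTower K R M] {𝓡 : ι → Submodule K R}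
    [SetLike.GradedMonoid 𝓡] (hR : ⨆ g, 𝓡 g = ⊤) (D : R →ₗ[K] ι →₀ R)
    (hD : ∀ g, ∀ r ∈ 𝓡 g, D r = Finsupp.single g r) (b : Module.Basis κ R M) (deg : κ → ι) :
    IsGradedModule 𝓡 (freeDeg 𝓡 b deg) := by
  have : SMulCommClass R K M := IsScalarTower.to_smulCommClass'
  -- The decomposition splits each coordinate by `D`, shifts its degrees by `deg β` and multiplies
  -- by `b β`.
  refine ⟨⟨?_⟩, isInternal_of_decomposition
    ((Finsupp.lsum K fun β => Finsupp.lmapDomain M K (· + deg β) ∘ₗ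
      Finsupp.mapRange.linearMap ((LinearMap.toSpanSingleton R M (b β)).restrictScalars K) ∘ₗ D) ∘ₗ
      b.repr.toLinearMap.restrictScalars K) ?_ ?_⟩
  · intro h g r x hr hx
    rw [vadd_eq_add]
    induction hx using Submodule.span_induction with
    | mem x hx =>
      obtain ⟨β, k, rfl, s, hs, rfl⟩ := hx
      rw [← mul_smul, ← add_assoc]
      exact smul_mem_freeDeg (SetLike.mul_mem_graded hr hs) β
    | zero => rw [smul_zero]; exact zero_mem _
    | add x y _ _ hx hy => rw [smul_add]; exact add_mem hx hy
    | smul c x _ hx => rw [smul_comm]; exact Submodule.smul_mem _ c hx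
  · intro g x hx
    induction hx using Submodule.span_induction with
    | mem x hx =>
      obtain ⟨β, h, rfl, r, hr, rfl⟩ := hx
      simp [hD h r hr, Finsupp.mapDomain_single]
    | zero => simp
    | add x y _ _ hx hy => rw [map_add, hx, hy, Finsupp.single_add]
    | smul c x _ hx => rw [map_smul, hx, Finsupp.smul_single]
  · rw [eq_top_iff]
    rintro x -
    rw [← b.linearCombination_repr x, Finsupp.linearCombination_apply]
    refine Submodule.sum_mem _ fun β _ => ?_
    suffices h : ⨆ g, 𝓡 g ≤ (⨆ g, freeDeg 𝓡 b deg g).comap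
        ((LinearMap.toSpanSingleton R M (b β)).restrictScalars K) from
      h (hR ▸ Submodule.mem_top (x := b.repr x β))
    exact iSup_le fun g r hr => Submodule.mem_iSup_of_mem _ (smul_mem_freeDeg hr β)

end Free

/-! ### Passage from the total free module to its terms of fixed length. -/

section Complex

variable {R : Type*} [Ring R] [Algebra K R] (X Y : Fin n → R)
  {M : ℕ → Type*} [∀ m, AddCommGroup (M m)] [∀ m, Module R (M m)]
  (b : ∀ m, Module.Basis (MultiIndex n m) R (M m))

/-- The coefficients of an element of the term in degree `m`. -/
def coeffs (m : ℕ) : M m →ₗ[R] (Fin n → ℕ) →₀ R :=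
  Finsupp.lmapDomain R R Subtype.val ∘ₗ (b m).repr.toLinearMap

/-- The element of the term in degree `m` with given coefficients; those at the `β` with
`|β| ≠ m` are ignored. -/
def ofCoeffs (m : ℕ) : ((Fin n → ℕ) →₀ R) →ₗ[R] M m :=
  Finsupp.linearCombination R fun β => if h : len β = m then b m ⟨β, h⟩ else 0

theorem coeffs_basis {m : ℕ} (β : MultiIndex n m) :
    coeffs b m (b m β) = Finsupp.single β.1 1 := by
  simp [coeffs, Finsupp.mapDomain_single]

theorem ofCoeffs_single (m : ℕ) (β : Fin n → ℕ) (r : R) :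
    ofCoeffs b m (Finsupp.single β r) = r • if h : len β = m then b m ⟨β, h⟩ else 0 := by
  simp [ofCoeffs]

theorem ofCoeffs_coeffs {m : ℕ} (x : M m) : ofCoeffs b m (coeffs b m x) = x := by
  suffices h : ofCoeffs b m ∘ₗ coeffs b m = LinearMap.id from LinearMap.congr_fun h x
  refine (b m).ext fun β => ?_
  rw [LinearMap.comp_apply, coeffs_basis, ofCoeffs_single, dif_pos β.2, one_smul,
    LinearMap.id_apply]

theorem coeffs_zero {m : ℕ} (x : M (m + 1)) : coeffs b (m + 1) x 0 = 0 := by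
  refine Finsupp.mapDomain_of_notMem_range _ _ ?_
  rintro ⟨β, hβ⟩
  have := β.2
  simp [hβ, len] at this

/-- The differential of the complex with terms `M m`. -/
def complexDiff (m : ℕ) : M (m + 1) →ₗ[R] M m :=
  ofCoeffs b m ∘ₗ diff q X Y ∘ₗ coeffs b (m + 1)

/-- The basis element with index `β - [j]`, or `0` if `β_j = 0`. -/
def basisSub {m : ℕ} (β : MultiIndex n (m + 1)) (j : Fin n) : M m :=
  if h : β.1 j = 0 then 0 else
    b m ⟨β.1 - Pi.single j 1, by have := len_sub_single h; have := β.2; omega⟩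

theorem complexDiff_basis {m : ℕ} (β : MultiIndex n (m + 1)) :
    complexDiff q X Y b m (b (m + 1) β) = ∑ j, diffCoeff q X Y β.1 j • basisSub b β j := by
  rw [complexDiff, LinearMap.comp_apply, LinearMap.comp_apply, coeffs_basis, diff_single, map_sum]
  refine Finset.sum_congr rfl fun j _ => ?_
  rw [basisSub]
  split_ifs with h
  · rw [map_zero, smul_zero]
  · rw [ofCoeffs_single, one_mul, dif_pos]

/-- Projection to a fixed length is a chain map, since `diff` lowers length by one. A primitive in
the total module may thus be cut down to the right degree. -/
theorem complexDiff_ofCoeffs (m : ℕ) (y : (Fin n → ℕ) →₀ R) :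
    complexDiff q X Y b m (ofCoeffs b (m + 1) y) = ofCoeffs b m (diff q X Y y) := by
  induction y using Finsupp.induction_linear with
  | zero => simp
  | add x y hx hy => simp only [map_add, hx, hy]
  | single β r =>
    rw [ofCoeffs_single, map_smul, ← mul_one r, ← smul_eq_mul, ← Finsupp.smul_single, map_smul,
      map_smul, smul_eq_mul, mul_one]
    congr 1
    by_cases h : len β = m + 1
    · rw [dif_pos h, complexDiff, LinearMap.comp_apply, LinearMap.comp_apply, coeffs_basis]
    · rw [dif_neg h, map_zero, diff_single, map_sum]
      refine (Finset.sum_eq_zero fun j _ => ?_).symm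
      split_ifs with hj
      · exact map_zero _
      · have := len_sub_single hj
        rw [ofCoeffs_single, dif_neg (by omega), smul_zero]

variable {X Y q}

theorem complexDiff_exact {S : Fin n → R →ₗ[K] R} (hq0 : ∀ i j, q i j ≠ 0)
    (hq : ∀ i j, i ≠ j → q i j * q j i = 1) (hR : EnvRel q X Y) (hS : SkewRel q X Y S) (m : ℕ) :
    Function.Exact (complexDiff q X Y b (m + 1)) (complexDiff q X Y b m) := by
  have hc : ∀ x, coeffs b m (complexDiff q X Y b m x) = diff q X Y (coeffs b (m + 1) x) := by
    intro x
    suffices h : coeffs b m ∘ₗ complexDiff q X Y b m = diff q X Y ∘ₗ coeffs b (m + 1) from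
      LinearMap.congr_fun h x
    refine (b (m + 1)).ext fun β => ?_
    rw [LinearMap.comp_apply, LinearMap.comp_apply, complexDiff_basis, coeffs_basis, diff_single,
      map_sum]
    refine Finset.sum_congr rfl fun j _ => ?_
    rw [basisSub, map_smul]
    split_ifs
    · rw [map_zero, smul_zero]
    · rw [coeffs_basis, Finsupp.smul_single, smul_eq_mul, mul_one, one_mul]
  intro x
  constructor
  · intro hx
    obtain ⟨y, hy⟩ := exists_diff_eq hq0 hq hR hS (x := coeffs b (m + 1) x)
      (by rw [← hc, hx, map_zero]) (coeffs_zero b x)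
    exact ⟨ofCoeffs b (m + 2) y, by rw [complexDiff_ofCoeffs, hy, ofCoeffs_coeffs]⟩
  · rintro ⟨y, rfl⟩
    rw [← ofCoeffs_coeffs b y, complexDiff_ofCoeffs, complexDiff_ofCoeffs, diff_diff hq hR,
      map_zero]

section Augmentation

variable {N : Type*} [AddCommGroup N] [Module R N] (u : N)

/-- The augmentation that maps the basis element of the term in degree `0` to `u`. -/
def augmentation : M 0 →ₗ[R] N := (b 0).constr ℕ fun _ => u

theorem augmentation_basis (β : MultiIndex n 0) : augmentation b u (b 0 β) = u :=
  (b 0).constr_basis ℕ _ _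

theorem eq_zero_of_len {β : Fin n → ℕ} (h : len β = 0) : β = 0 :=
  funext fun i => Finset.sum_eq_zero_iff.mp h i (Finset.mem_univ i)

theorem exists_eq_smul (x : M 0) : ∃ r : R, x = r • b 0 ⟨0, by simp [len]⟩ := by
  have : Unique (MultiIndex n 0) :=
    ⟨⟨⟨0, by simp [len]⟩⟩, fun β => Subtype.ext (eq_zero_of_len β.2)⟩
  refine ⟨(b 0).repr x ⟨0, by simp [len]⟩, ?_⟩
  conv_lhs => rw [← (b 0).sum_repr x]
  rw [Fintype.sum_subsingleton]

variable {u}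

theorem augmentation_exact
    (hu : ∀ r : R, r • u = 0 ↔ r ∈ Submodule.span R (Set.range fun j => X j - Y j)) :
    Function.Exact (complexDiff q X Y b 0) (augmentation b u) := by
  intro x
  constructor
  · intro hx
    obtain ⟨r, rfl⟩ := exists_eq_smul b x
    rw [map_smul, augmentation_basis, hu] at hx
    obtain ⟨y, hy⟩ := exists_diff_eq_single_zero (q := q) r hx
    exact ⟨ofCoeffs b 1 y, by rw [complexDiff_ofCoeffs, hy, ofCoeffs_single, dif_pos]⟩
  · rintro ⟨y, rfl⟩
    suffices h : augmentation b u ∘ₗ complexDiff q X Y b 0 = 0 from LinearMap.congr_fun h y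
    refine (b 1).ext fun β => ?_
    rw [LinearMap.comp_apply, complexDiff_basis, map_sum, LinearMap.zero_apply]
    refine Finset.sum_eq_zero fun j _ => ?_
    rw [basisSub, map_smul]
    split_ifs with h
    -- In the remaining case `β = [j]`, with coefficient `X j - Y j`.
    · rw [map_zero, smul_zero]
    · have h0 := eq_zero_of_len (β := β.1 - Pi.single j 1)
        (by have := len_sub_single h; have := β.2; omega)
      have hβ := sub_single_add h
      rw [h0] at hβ
      have hl := leftCoeff_add_single q 0 j j
      have hr := rightCoeff_add_single q 0 j j
      rw [augmentation_basis, ← hβ, diffCoeff, hl, hr, leftCoeff_zero, rightCoeff_zero, hu]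
      refine Submodule.subset_span ⟨j, ?_⟩
      simp [sub_eq_add_neg]

end Augmentation

section Grading

variable {ι : Type*} [AddCommMonoid ι] {w : Fin n → ι} {𝓡 : ι → Submodule K R}
  [∀ m, Module K (M m)] [∀ m, IsScalarTower K R (M m)]

variable (w) in
/-- The degree of `ε_β`. -/
def multiDeg {m : ℕ} (β : MultiIndex n m) : ι := ∑ i, β.1 i • w i

theorem complexDiff_mem [SetLike.GradedMonoid 𝓡] (hX : ∀ j, X j ∈ 𝓡 (w j)) (hY : ∀ j, Y j ∈ 𝓡 (w j)) {m : ℕ} {g : ι}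
    {x : M (m + 1)} (hx : x ∈ freeDeg 𝓡 (b (m + 1)) (multiDeg w) g) :
    complexDiff q X Y b m x ∈ freeDeg 𝓡 (b m) (multiDeg w) g := by
  suffices h : freeDeg 𝓡 (b (m + 1)) (multiDeg w) g ≤
      (freeDeg 𝓡 (b m) (multiDeg w) g).comap ((complexDiff q X Y b m).restrictScalars K) from h hx
  refine Submodule.span_le.mpr ?_
  rintro _ ⟨β, h, rfl, r, hr, rfl⟩
  change complexDiff q X Y b m (r • b (m + 1) β) ∈ freeDeg 𝓡 (b m) (multiDeg w) _
  rw [map_smul, complexDiff_basis, Finset.smul_sum]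
  refine Submodule.sum_mem _ fun j _ => ?_
  rw [basisSub, ← mul_smul]
  split_ifs with hj
  · rw [smul_zero]
    exact zero_mem _
  · have hlen : len (β.1 - Pi.single j 1) = m := by
      have := len_sub_single hj
      have := β.2
      omega
    have hdeg : multiDeg w β = w j + multiDeg w (⟨_, hlen⟩ : MultiIndex n m) := by
      rw [multiDeg, multiDeg]
      conv_lhs => rw [← sub_single_add hj]
      simp [add_smul, Finset.sum_add_distrib, Pi.single_apply, add_comm]
    have hmem : r * diffCoeff q X Y β.1 j ∈ 𝓡 (h + w j) :=
      SetLike.mul_mem_graded hr (add_mem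
        (Submodule.smul_mem _ _ (hX j)) (Submodule.smul_mem _ _ (hY j)))
    rw [hdeg, ← add_assoc]
    exact smul_mem_freeDeg hmem (⟨_, hlen⟩ : MultiIndex n m)

variable {N : Type*} [AddCommGroup N] [Module K N] [Module R N] [IsScalarTower K R N]
  {𝓝 : ι → Submodule K N} {u : N}

theorem augmentation_mem [SetLike.GradedSMul 𝓡 𝓝] (hu : u ∈ 𝓝 0) {g : ι} {x : M 0}
    (hx : x ∈ freeDeg 𝓡 (b 0) (multiDeg w) g) : augmentation b u x ∈ 𝓝 g := by
  suffices h : freeDeg 𝓡 (b 0) (multiDeg w) g ≤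
      (𝓝 g).comap ((augmentation b u).restrictScalars K) from h hx
  refine Submodule.span_le.mpr ?_
  rintro _ ⟨β, h, rfl, r, hr, rfl⟩
  change augmentation b u (r • b 0 β) ∈ 𝓝 _
  rw [map_smul, augmentation_basis, multiDeg, eq_zero_of_len β.2]
  simpa using SetLike.GradedSMul.smul_mem hr hu

theorem isGradedProjectiveResolution_complexDiff [DecidableEq ι] [SetLike.GradedMonoid 𝓡]
    {S : Fin n → R →ₗ[K] R}
    (hq0 : ∀ i j, q i j ≠ 0) (hq : ∀ i j, i ≠ j → q i j * q j i = 1) (hR : EnvRel q X Y)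
    (hS : SkewRel q X Y S) (hX : ∀ j, X j ∈ 𝓡 (w j)) (hY : ∀ j, Y j ∈ 𝓡 (w j))
    (htop : ⨆ g, 𝓡 g = ⊤) (D : R →ₗ[K] ι →₀ R)
    (hD : ∀ g, ∀ r ∈ 𝓡 g, D r = Finsupp.single g r) (hN : IsGradedModule 𝓡 𝓝) (hu0 : u ∈ 𝓝 0)
    (hu : ∀ r : R, r • u = 0 ↔ r ∈ Submodule.span R (Set.range fun j => X j - Y j))
    (hsurj : ∀ y, ∃ r : R, r • u = y) :
    IsGradedProjectiveResolution 𝓡 𝓝 (fun m => freeDeg 𝓡 (b m) (multiDeg w))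
      (complexDiff q X Y b) (augmentation b u) where
  gradedAlgebra := ⟨inferInstance, isInternal_of_decomposition D hD htop⟩
  gradedModule := hN
  gradedTerm m := isGradedModule_freeDeg htop D hD (b m) (multiDeg w)
  projective m := Module.Projective.of_basis (b m)
  d_mem _ _ _ hx := complexDiff_mem b hX hY hx
  aug_mem _ _ hx := have := hN.gradedSMul; augmentation_mem b hu0 hx
  exact := complexDiff_exact b hq0 hq hR hS
  exact_zero := augmentation_exact b hu
  surjective y := by
    obtain ⟨r, rfl⟩ := hsurj y
    exact ⟨r • b 0 ⟨0, by simp [len]⟩, by rw [map_smul, augmentation_basis]⟩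

end Grading

end Complex

/-! ### The relations in `Λ^e` and the kernel of multiplication. -/

/-- The element `v_j ⊗ 1` of `Λ^e`. -/
def leftV (j : Fin n) : Env q := v q j ⊗ₜ[K] 1

/-- The element `1 ⊗ v_j` of `Λ^e`. -/
def rightV (j : Fin n) : Env q := 1 ⊗ₜ[K] MulOpposite.op (v q j)

theorem envRel : EnvRel q (leftV q) (rightV q) where
  X_comm i j h := by
    simp only [leftV, Algebra.TensorProduct.tmul_mul_tmul, v_comm q h, TensorProduct.smul_tmul']
  X_sq i := by
    rw [leftV, Algebra.TensorProduct.tmul_mul_tmul, v_sq]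
    exact TensorProduct.zero_tmul _ _
  Y_comm i j h := by
    simp only [rightV, Algebra.TensorProduct.tmul_mul_tmul, ← MulOpposite.op_mul, v_comm q h,
      MulOpposite.op_smul, TensorProduct.tmul_smul]
  Y_sq i := by
    rw [rightV, Algebra.TensorProduct.tmul_mul_tmul, ← MulOpposite.op_mul, v_sq]
    exact TensorProduct.tmul_zero _ _
  comm i j := by
    simp only [leftV, rightV, Algebra.TensorProduct.tmul_mul_tmul, one_mul, mul_one]

theorem skewRel (hq : ∀ i j, i ≠ j → q i j * q j i = 1) :
    SkewRel q (leftV q) (rightV q) fun j => (skew q hq j).rTensor (Lam q)ᵐᵒᵖ where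
  mul_X_self j r := by
    induction r using TensorProduct.induction_on with
    | zero => rw [zero_mul, map_zero, zero_mul, sub_zero]
    | tmul a b =>
      simp only [leftV, Algebra.TensorProduct.tmul_mul_tmul, LinearMap.rTensor_tmul,
        skew_mul_v_self, TensorProduct.sub_tmul, mul_one]
    | add x y hx hy => rw [add_mul, map_add, hx, hy, map_add, add_mul, add_sub_add_comm]
  mul_X_ne i j r h := by
    induction r using TensorProduct.induction_on with
    | zero => rw [zero_mul, map_zero, zero_mul, smul_zero]
    | tmul a b =>
      simp only [leftV, Algebra.TensorProduct.tmul_mul_tmul, LinearMap.rTensor_tmul,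
        skew_mul_v_ne q hq j h, TensorProduct.smul_tmul', mul_one]
    | add x y hx hy => rw [add_mul, map_add, hx, hy, map_add, add_mul, smul_add]
  mul_Y i j r := by
    induction r using TensorProduct.induction_on with
    | zero => rw [zero_mul, map_zero, zero_mul]
    | tmul a b =>
      simp only [rightV, Algebra.TensorProduct.tmul_mul_tmul, LinearMap.rTensor_tmul, mul_one]
    | add x y hx hy => rw [add_mul, map_add, hx, hy, map_add, add_mul]

/-- Modulo the left ideal, `a v_j ⊗ b ≡ a ⊗ v_j b`, so generators move one by one to the right
factor and `a ⊗ b ≡ 1 ⊗ ab`. -/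
theorem sub_mem_span (r : Env q) : r - 1 ⊗ₜ[K] MulOpposite.op (r • (1 : Lam q)) ∈
    Submodule.span (Env q) (Set.range fun j => leftV q j - rightV q j) := by
  set J := Submodule.span (Env q) (Set.range fun j => leftV q j - rightV q j)
  induction r using TensorProduct.induction_on with
  | zero =>
    rw [zero_smul (Env q) (1 : Lam q), MulOpposite.op_zero, TensorProduct.tmul_zero, sub_zero]
    exact J.zero_mem
  | tmul a b =>
    obtain ⟨b, rfl⟩ := MulOpposite.op_surjective b
    rw [env_smul_lam, mul_one]
    induction a using lam_induction generalizing b with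
    | one =>
      rw [one_mul, sub_self]
      exact J.zero_mem
    | mul_v a j ih =>
      have h := J.smul_mem (a ⊗ₜ MulOpposite.op b)
        (Submodule.subset_span ⟨j, rfl⟩ : leftV q j - rightV q j ∈ J)
      rw [smul_eq_mul, mul_sub, leftV, rightV, Algebra.TensorProduct.tmul_mul_tmul,
        Algebra.TensorProduct.tmul_mul_tmul, mul_one, mul_one, ← MulOpposite.op_mul] at h
      have := J.add_mem h (ih (v q j * b))
      rwa [sub_add_sub_cancel, ← mul_assoc] at this
    | add x y hx hy =>
      have := J.add_mem (hx b) (hy b)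
      rwa [← add_sub_add_comm, ← TensorProduct.add_tmul, ← TensorProduct.tmul_add,
        ← MulOpposite.op_add, ← add_mul] at this
    | smul c x hx =>
      have := (J.restrictScalars K).smul_mem c (hx b)
      rwa [smul_sub, TensorProduct.smul_tmul', ← TensorProduct.tmul_smul,
        ← MulOpposite.op_smul, ← smul_mul_assoc] at this
  | add x y hx hy =>
    have := J.add_mem hx hy
    rwa [← add_sub_add_comm, ← TensorProduct.tmul_add, ← MulOpposite.op_add, ← add_smul] at this

theorem smul_one_eq_zero_iff (r : Env q) : r • (1 : Lam q) = 0 ↔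
    r ∈ Submodule.span (Env q) (Set.range fun j => leftV q j - rightV q j) := by
  constructor
  · intro h
    have := sub_mem_span q r
    rwa [h, MulOpposite.op_zero, TensorProduct.tmul_zero, sub_zero] at this
  · intro h
    suffices hle : Submodule.span (Env q) (Set.range fun j => leftV q j - rightV q j) ≤
        LinearMap.ker (LinearMap.toSpanSingleton (Env q) (Lam q) 1) from hle h
    refine Submodule.span_le.mpr ?_
    rintro _ ⟨j, rfl⟩
    change (leftV q j - rightV q j) • (1 : Lam q) = 0
    have h1 : leftV q j • (1 : Lam q) = v q j :=
      (env_smul_lam q (v q j) 1 1).trans (by simp)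
    have h2 : rightV q j • (1 : Lam q) = v q j :=
      (env_smul_lam q 1 (v q j) 1).trans (by simp)
    rw [sub_smul, h1, h2, sub_self]

/-! ### Gradings of `Λ` and `Λ^e` by arbitrary weights. -/

section Grading

variable {ι : Type*} [AddCommMonoid ι] (w : Fin n → ι)

theorem v_mem_lamDeg (j : Fin n) : v q j ∈ lamDeg q w (w j) :=
  Submodule.subset_span ⟨[j], by simp⟩

theorem one_mem_lamDeg : (1 : Lam q) ∈ lamDeg q w 0 :=
  Submodule.subset_span ⟨[], by simp⟩

theorem mul_mem_lamDeg {g h : ι} {a b : Lam q} (ha : a ∈ lamDeg q w g)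
    (hb : b ∈ lamDeg q w h) : a * b ∈ lamDeg q w (g + h) := by
  refine (Submodule.span_mul_span K _ _).le.trans (Submodule.span_mono ?_)
    (Submodule.mul_mem_mul ha hb)
  rintro _ ⟨_, ⟨s, rfl, rfl⟩, _, ⟨t, rfl, rfl⟩, rfl⟩
  exact ⟨s ++ t, by simp⟩

theorem iSup_lamDeg : ⨆ g, lamDeg q w g = ⊤ := by
  rw [eq_top_iff, ← span_words, Submodule.span_le]
  rintro _ ⟨s, rfl⟩
  exact Submodule.mem_iSup_of_mem _ (Submodule.subset_span ⟨s, rfl, rfl⟩)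

/-- The coaction of the monoid algebra of `ι` on `Λ`. -/
def lamCoaction : Lam q →ₐ[K] AddMonoidAlgebra (Lam q) ι :=
  lamLift q (fun i => AddMonoidAlgebra.single (w i) (v q i))
    (fun i j h => by
      rw [AddMonoidAlgebra.single_mul_single, AddMonoidAlgebra.single_mul_single, v_comm q h,
        AddMonoidAlgebra.smul_single, add_comm])
    (fun i => by rw [AddMonoidAlgebra.single_mul_single, v_sq, AddMonoidAlgebra.single_zero])

/-- The decomposition of the elements of `Λ` into homogeneous components. -/
def lamDecomp : Lam q →ₗ[K] ι →₀ Lam q :=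
  (AddMonoidAlgebra.coeffLinearEquiv K).toLinearMap ∘ₗ (lamCoaction q w).toLinearMap

theorem lamDecomp_of_mem {g : ι} {x : Lam q} (hx : x ∈ lamDeg q w g) :
    lamDecomp q w x = Finsupp.single g x := by
  induction hx using Submodule.span_induction with
  | mem x h =>
    obtain ⟨s, rfl, rfl⟩ := h
    suffices h : lamCoaction q w (s.map (v q)).prod =
        AddMonoidAlgebra.single (s.map w).sum (s.map (v q)).prod by
      simp [lamDecomp, h]
    induction s with
    | nil => simp [AddMonoidAlgebra.one_def]
    | cons i s ih =>
      simp only [List.map_cons, List.prod_cons, List.sum_cons, map_mul, ih]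
      rw [lamCoaction, lamLift_v, AddMonoidAlgebra.single_mul_single]
  | zero => simp
  | add x y _ _ hx hy => rw [map_add, hx, hy, Finsupp.single_add]
  | smul c x _ hx => rw [map_smul, hx, Finsupp.smul_single]

theorem tmul_mem_envDeg {g h : ι} {a b : Lam q} (ha : a ∈ lamDeg q w g)
    (hb : b ∈ lamDeg q w h) : a ⊗ₜ[K] MulOpposite.op b ∈ envDeg q w (g + h) :=
  Submodule.subset_span ⟨g, h, rfl, a, ha, b, hb, rfl⟩

theorem leftV_mem_envDeg (j : Fin n) : leftV q j ∈ envDeg q w (w j) := by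
  have := tmul_mem_envDeg q w (v_mem_lamDeg q w j) (one_mem_lamDeg q w)
  rwa [add_zero] at this

theorem rightV_mem_envDeg (j : Fin n) : rightV q j ∈ envDeg q w (w j) := by
  have := tmul_mem_envDeg q w (one_mem_lamDeg q w) (v_mem_lamDeg q w j)
  rwa [zero_add] at this

instance gradedMonoid_envDeg : SetLike.GradedMonoid (envDeg q w) where
  one_mem := by
    have := tmul_mem_envDeg q w (one_mem_lamDeg q w) (one_mem_lamDeg q w)
    rwa [add_zero] at this
  mul_mem g h r s hr hs := by
    refine (Submodule.span_mul_span K _ _).le.trans (Submodule.span_mono ?_)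
      (Submodule.mul_mem_mul hr hs)
    rintro _ ⟨_, ⟨g₁, g₂, rfl, a, ha, b, hb, rfl⟩, _, ⟨h₁, h₂, rfl, c, hc, d, hd, rfl⟩, rfl⟩
    -- The second factor multiplies in reverse order, as in `Λ^op`.
    refine ⟨g₁ + h₁, h₂ + g₂, by abel, a * c, mul_mem_lamDeg q w ha hc, d * b,
      mul_mem_lamDeg q w hd hb, ?_⟩
    exact Algebra.TensorProduct.tmul_mul_tmul _ _ _ _

theorem iSup_envDeg : ⨆ g, envDeg q w g = ⊤ := by
  have htop : ∀ a : Lam q, a ∈ ⨆ g, lamDeg q w g := fun a => iSup_lamDeg q w ▸ Submodule.mem_top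
  rw [eq_top_iff, ← TensorProduct.span_tmul_eq_top, Submodule.span_le]
  rintro _ ⟨a, b, rfl⟩
  obtain ⟨b, rfl⟩ := MulOpposite.op_surjective b
  change a ⊗ₜ[K] MulOpposite.op b ∈ ⨆ g, envDeg q w g
  induction htop a using Submodule.iSup_induction' with
  | mem g a ha =>
    induction htop b using Submodule.iSup_induction' with
    | mem h b hb => exact Submodule.mem_iSup_of_mem _ (tmul_mem_envDeg q w ha hb)
    | zero => rw [MulOpposite.op_zero, TensorProduct.tmul_zero]; exact zero_mem _
    | add x y _ _ hx hy =>
      rw [MulOpposite.op_add, TensorProduct.tmul_add]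
      exact add_mem hx hy
  | zero => rw [TensorProduct.zero_tmul]; exact zero_mem _
  | add x y _ _ hx hy =>
    rw [TensorProduct.add_tmul]
    exact add_mem hx hy

/-- The decomposition of the elements of `Λ^e` into homogeneous components. -/
def envDecomp : Env q →ₗ[K] ι →₀ Env q :=
  Finsupp.lmapDomain (Env q) K (fun p : ι × ι => p.1 + p.2) ∘ₗ
    (finsuppTensorFinsupp K K (Lam q) (Lam q)ᵐᵒᵖ ι ι).toLinearMap ∘ₗ
      TensorProduct.map (lamDecomp q w)
        (Finsupp.mapRange.linearMap (MulOpposite.opLinearEquiv K).toLinearMap ∘ₗ lamDecomp q w ∘ₗ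
          (MulOpposite.opLinearEquiv K).symm.toLinearMap)

theorem envDecomp_of_mem (g : ι) (r : Env q) (hr : r ∈ envDeg q w g) :
    envDecomp q w r = Finsupp.single g r := by
  induction hr using Submodule.span_induction with
  | mem r h =>
    obtain ⟨h, k, rfl, a, ha, b, hb, rfl⟩ := h
    simp [envDecomp, lamDecomp_of_mem q w ha, lamDecomp_of_mem q w hb, Finsupp.mapDomain_single]
  | zero => rw [map_zero]; exact (Finsupp.single_zero _).symm
  | add x y _ _ hx hy => rw [map_add, hx, hy]; exact (Finsupp.single_add _ _ _).symm
  | smul c x _ hx => rw [map_smul, hx]; exact Finsupp.smul_single _ _ _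

theorem isGradedModule_lamDeg [DecidableEq ι] : IsGradedModule (envDeg q w) (lamDeg q w) where
  gradedSMul := ⟨by
    intro g h r x hr hx
    rw [vadd_eq_add]
    induction hr using Submodule.span_induction with
    | mem r hr =>
      obtain ⟨g₁, g₂, rfl, a, ha, b, hb, rfl⟩ := hr
      rw [env_smul_lam, show g₁ + g₂ + h = g₁ + h + g₂ by abel]
      exact mul_mem_lamDeg q w (mul_mem_lamDeg q w ha hx) hb
    | zero => exact (zero_smul (Env q) x).symm ▸ zero_mem _
    | add r s _ _ hr hs => rw [add_smul]; exact add_mem hr hs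
    | smul c r _ hr => rw [smul_assoc]; exact Submodule.smul_mem _ c hr⟩
  isInternal := isInternal_of_decomposition (lamDecomp q w)
    (fun _ _ hx => lamDecomp_of_mem q w hx) (iSup_lamDeg q w)

theorem CDeg_eq_freeDeg (m : ℕ) :
    CDeg q w m = freeDeg (envDeg q w) (basisC q m) (multiDeg w) := by
  funext g
  simp only [freeDeg, basisC_apply]
  rfl

end Grading

/-! ### The resolution of `Λ`. -/

/-- The differential of the complex `C`. -/
def differential (m : ℕ) : C q (m + 1) →ₗ[Env q] C q m :=
  complexDiff (M := fun m => C q m) q (leftV q) (rightV q) (basisC q) m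

/-- The augmentation of the complex `C`. -/
def multiplication : C q 0 →ₗ[Env q] Lam q :=
  augmentation (M := fun m => C q m) (basisC q) (1 : Lam q)

theorem basisSub_basisC {m : ℕ} (β : MultiIndex n (m + 1)) (j : Fin n) :
    basisSub (M := fun m => C q m) (basisC q) β j = genSub q β j := by
  rw [basisSub, genSub]
  split_ifs
  · rfl
  · exact basisC_apply q _

theorem diffCoeff_smul {m : ℕ} (β : Fin n → ℕ) (j : Fin n) (x : C q m) :
    diffCoeff q (leftV q) (rightV q) β j • x =
      (-1 : K) ^ (∑ l ∈ Finset.Iio j, β l) •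
        ((∏ l ∈ Finset.Iio j, q j l ^ β l) • (leftV q j • x) +
          ((-1 : K) ^ β j * ∏ l ∈ Finset.Ioi j, q l j ^ β l) • (rightV q j • x)) := by
  rw [diffCoeff, add_smul, smul_assoc, smul_assoc, leftCoeff, rightCoeff, smul_add, smul_smul,
    smul_smul]

theorem differential_gen {m : ℕ} (β : MultiIndex n (m + 1)) :
    differential q m (gen q β) =
      ∑ j, diffCoeff q (leftV q) (rightV q) β.1 j • genSub q β j := by
  have h := complexDiff_basis (M := fun m => C q m) q (leftV q) (rightV q) (basisC q) β
  simp only [basisC_apply, basisSub_basisC] at h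
  exact h

theorem isDifferential_differential : IsDifferential q (differential q) := by
  intro m β
  rw [differential_gen]
  exact Finset.sum_congr rfl fun j _ => diffCoeff_smul q β.1 j _

theorem isAugmentation_multiplication : IsAugmentation q (multiplication q) := by
  have h := augmentation_basis (M := fun m => C q m) (basisC q) (1 : Lam q) ⟨0, by simp [len]⟩
  rw [basisC_apply] at h
  exact h

theorem isGradedProjectiveResolution {ι : Type*} [AddCommMonoid ι] [DecidableEq ι]
    (w : Fin n → ι) (hq0 : ∀ i j, q i j ≠ 0) (hq : ∀ i j, i ≠ j → q i j * q j i = 1) :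
    IsGradedProjectiveResolution (P := fun m => C q m) (envDeg q w) (lamDeg q w) (CDeg q w)
      (differential q) (multiplication q) := by
  have h := isGradedProjectiveResolution_complexDiff (M := fun m => C q m) (basisC q) hq0 hq
    (envRel q) (skewRel q hq)
    (leftV_mem_envDeg q w) (rightV_mem_envDeg q w) (iSup_envDeg q w) (envDecomp q w)
    (envDecomp_of_mem q w) (isGradedModule_lamDeg q w) (one_mem_lamDeg q w)
    (smul_one_eq_zero_iff q)
    fun y => ⟨y ⊗ₜ 1, (env_smul_lam q y 1 1).trans (by rw [mul_one, mul_one])⟩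
  have hC : (fun m => freeDeg (envDeg q w) (basisC q m) (multiDeg w)) = CDeg q w :=
    funext fun m => (CDeg_eq_freeDeg q w m).symm
  exact hC ▸ h

end QuantumExterior

end

open QuantumExterior in
/-- The first conjunct says that each `C_m` is the direct sum of the `Λ ε_β Λ`, `|β| = m`. The
resolution is graded both for the `ℕ^n`-grading with `v_j` in degree `[j]` and `ε_β` in degree
`β`, and for the `ℕ`-grading with `v_j` in degree `1` and `ε_β` in degree `|β|`. -/
theorem mainTheorem8 {K : Type*} [Field K] (hK : ringChar K ≠ 2) (n : ℕ)
    (q : Fin n → Fin n → K) (hq0 : ∀ i j, q i j ≠ 0)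
    (hq : ∀ i j, i ≠ j → q i j * q j i = 1) :
    (∀ m, iSupIndep fun β : MultiIndex n m => epsSpan q β.1) ∧
    ∃ (d : ∀ m, C q (m + 1) →ₗ[Env q] C q m) (μ : C q 0 →ₗ[Env q] Lam q),
      IsDifferential q d ∧ IsAugmentation q μ ∧
      IsGradedProjectiveResolution (ι := Fin n → ℕ) (P := fun m => C q m)
        (envDeg q fun j => Pi.single j 1) (lamDeg q fun j => Pi.single j 1)
        (CDeg q fun j => Pi.single j 1) d μ ∧
      IsGradedProjectiveResolution (ι := ℕ) (P := fun m => C q m)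
        (envDeg q fun _ => 1) (lamDeg q fun _ => 1) (CDeg q fun _ => 1) d μ := by
  exact ⟨iSupIndep_epsSpan q, differential q, multiplication q, isDifferential_differential q,
    isAugmentation_multiplication q, isGradedProjectiveResolution q _ hq0 hq,
    isGradedProjectiveResolution q _ hq0 hq⟩
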